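/- Let $L/K$ be a finite extension of number fields with rings of integers $\mathcal O_K$ and $\mathcal O_L$, such that $L=K(\alpha)$ with $\alpha$ a root of a monic irreducible polynomial $f(x)\in\mathcal O_K[x]$. Let $\mathfrak p$ be a nonzero prime ideal of $\mathcal O_K$, and write $\mathfrak p\mathcal O_L=\prod_i\mathfrak P_i^{e_i}$, where the $\mathfrak P_i$ are distinct prime ideals of $\mathcal O_L$ and all $e_i\ge 1$. Let $f_i=[\mathcal O_L/\mathfrak P_i:\mathcal O_K/\mathfrak p]$ be the inertial degree of $\mathfrak P_i$ over $\mathfrak p$. Then there are polynomials $g_i\in\mathcal O_K[x]$, one for each $i$, with $\deg g_i=f_i$ and $$f\equiv\prod_i g_i^{e_i}\pmod{\mathfrak p},$$ that is, all coefficients of $f-\prod_i g_i^{e_i}$ lie in $\mathfrak p$. (Nothing is assumed about the index of $\mathcal O_K[\alpha]$ in $\mathcal O_L$, and the $g_i$ are not asserted to be irreducible, over $K$ or modulo $\mathfrak p$.) -/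

import Mathlib

open Polynomial
open scoped NumberField

open Module

/-! Let `k = R ⧸ p`. Modulo `p`, the minimal polynomial of an integral generator `x` is the
characteristic polynomial of multiplication by `x` on `S ⧸ pS` (`charpoly_lmul_quotient_map`).
Adding the prime factors of `pS` one at a time, with multiplicity, filters `S ⧸ pS` by ideals whose
successive quotients `I ⧸ IP` are isomorphic to `S ⧸ P`. Multiplicativity along this filtration
(`Ideal.quotientCharpoly_map_prod`) gives one factor per prime, of degree `[S ⧸ P : k]`; lifting
these monic factors to `R` gives the `g i`. The order `R[x]` never enters, so its index is
irrelevant. -/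

/-- The characteristic polynomial is multiplicative in short exact sequences of free modules. -/
theorem LinearMap.charpoly_eq_mul_of_submodule {R V : Type*} [CommRing R] [AddCommGroup V]
    [Module R V] [Module.Free R V] [Module.Finite R V] (W : Submodule R V)
    [Module.Free R W] [Module.Finite R W] [Module.Free R (V ⧸ W)]
    (φ : End R V) (hφ : W ≤ W.comap φ) :
    φ.charpoly = (φ.restrict hφ).charpoly * (W.mapQ W φ hφ).charpoly := by
  classical
  nontriviality R
  let bW := Free.chooseBasis R W
  let bQ := Free.chooseBasis R (V ⧸ W)
  let b := bW.sumQuot bQ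
  have key : toMatrix b b φ = Matrix.fromBlocks (toMatrix bW bW (φ.restrict hφ))
      (Matrix.of fun i j => b.repr (φ (b (Sum.inr j))) (Sum.inl i)) 0
      (toMatrix bQ bQ (W.mapQ W φ hφ)) := by
    ext i j
    rcases j with j | j <;> rcases i with i | i
    · simp only [b, Matrix.fromBlocks_apply₁₁, toMatrix_apply, Basis.sumQuot_inl]
      exact Basis.sumQuot_repr_inl_of_mem bW bQ _ (hφ (bW j).2) i
    · simp only [b, Matrix.fromBlocks_apply₂₁, toMatrix_apply, Basis.sumQuot_inl]
      exact Basis.sumQuot_repr_inr_of_mem bW bQ _ (hφ (bW j).2) i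
    · simp [b, toMatrix_apply]
    · simp only [b, Matrix.fromBlocks_apply₂₂, toMatrix_apply, Basis.sumQuot_repr_inr]
      rw [← Basis.sumQuot_inr bW bQ j, W.mapQ_apply, W.mkQ_apply]
  rw [← charpoly_toMatrix φ b, key, Matrix.charpoly_fromBlocks_zero₂₁, charpoly_toMatrix,
    charpoly_toMatrix]

theorem LinearMap.charpoly_eq_of_equiv {R V W : Type*} [CommRing R] [AddCommGroup V]
    [Module R V] [Module.Free R V] [Module.Finite R V] [AddCommGroup W] [Module R W]
    [Module.Free R W] [Module.Finite R W] (e : V ≃ₗ[R] W) (φ : End R V) (ψ : End R W)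
    (h : ∀ v, e (φ v) = ψ (e v)) : φ.charpoly = ψ.charpoly := by
  rw [← LinearEquiv.charpoly_conj e φ]
  congr 1
  ext w
  simp [LinearEquiv.conj_apply, h]

theorem LinearMap.charpoly_eq_mul_of_exact {k V₁ V₂ V₃ : Type*} [Field k]
    [AddCommGroup V₁] [Module k V₁] [Module.Finite k V₁]
    [AddCommGroup V₂] [Module k V₂] [Module.Finite k V₂]
    [AddCommGroup V₃] [Module k V₃] [Module.Finite k V₃]
    (i : V₁ →ₗ[k] V₂) (q : V₂ →ₗ[k] V₃) (hi : Function.Injective i) (hq : Function.Surjective q)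
    (hiq : Function.Exact i q) (φ₁ : End k V₁) (φ₂ : End k V₂) (φ₃ : End k V₃)
    (h₁ : ∀ v, i (φ₁ v) = φ₂ (i v)) (h₃ : ∀ v, q (φ₂ v) = φ₃ (q v)) :
    φ₂.charpoly = φ₁.charpoly * φ₃.charpoly := by
  have hφ : range i ≤ (range i).comap φ₂ := by
    rintro _ ⟨v, rfl⟩
    exact ⟨φ₁ v, h₁ v⟩
  rw [charpoly_eq_mul_of_submodule (range i) φ₂ hφ]
  congr 1
  · refine (charpoly_eq_of_equiv (LinearEquiv.ofInjective i hi) _ _ fun v => ?_).symm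
    exact Subtype.ext (h₁ v)
  · let e := (Submodule.quotEquivOfEq _ _ hiq.linearMap_ker_eq.symm).trans
      (q.quotKerEquivOfSurjective hq)
    refine charpoly_eq_of_equiv e _ _ fun v => ?_
    obtain ⟨v, rfl⟩ := Submodule.Quotient.mk_surjective _ v
    exact h₃ v

/-! ### Characteristic polynomials on quotient rings -/

/-- The characteristic polynomial of multiplication by `a` on `B ⧸ J`. -/
noncomputable def Ideal.quotientCharpoly (k : Type*) {B : Type*} [Field k] [CommRing B]
    [Algebra k B] [Module.Finite k B] (a : B) (J : Ideal B) : k[X] :=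
  (Algebra.lmul k (B ⧸ J) (Ideal.Quotient.mk J a)).charpoly

/-- Multiplication by `x` gives a short exact sequence `0 → B ⧸ Q → B ⧸ J → B ⧸ I → 0` commuting
with `a`. -/
theorem Ideal.quotientCharpoly_mul {k B : Type*} [Field k] [CommRing B]
    [Algebra k B] [Module.Finite k B] (a : B) {I J Q : Ideal B} (x : B)
    (hJI : J ≤ I) (hxI : x ∈ I) (hIJ : I ≤ span {x} ⊔ J) (hx : ∀ b, x * b ∈ J ↔ b ∈ Q) :
    quotientCharpoly k a J = quotientCharpoly k a Q * quotientCharpoly k a I := by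
  let i : (B ⧸ Q) →ₗ[B] B ⧸ J :=
    Submodule.mapQ Q J (LinearMap.mulLeft B x) fun b hb => (hx b).2 hb
  let q : (B ⧸ J) →ₗ[B] B ⧸ I := Submodule.factor hJI
  refine LinearMap.charpoly_eq_mul_of_exact (i.restrictScalars k) (q.restrictScalars k)
    ?_ ?_ ?_ _ _ _ ?_ ?_
  · rw [LinearMap.coe_restrictScalars, injective_iff_map_eq_zero]
    intro b hb
    obtain ⟨b, rfl⟩ := Ideal.Quotient.mk_surjective b
    exact Ideal.Quotient.eq_zero_iff_mem.2 ((hx b).1 (Ideal.Quotient.eq_zero_iff_mem.1 hb))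
  · exact Submodule.factor_surjective hJI
  · intro b
    obtain ⟨b, rfl⟩ := Ideal.Quotient.mk_surjective b
    constructor
    · intro hb
      have hb : b ∈ I := Ideal.Quotient.eq_zero_iff_mem.1 hb
      obtain ⟨y, hy, z, hz, rfl⟩ := Submodule.mem_sup.1 (hIJ hb)
      obtain ⟨c, rfl⟩ := Ideal.mem_span_singleton'.1 hy
      refine ⟨Ideal.Quotient.mk Q c, ?_⟩
      change Ideal.Quotient.mk J (x * c) = _
      rw [Ideal.Quotient.eq, mul_comm x c, sub_add_cancel_left]
      exact neg_mem hz
    · rintro ⟨c, hc⟩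
      obtain ⟨c, rfl⟩ := Ideal.Quotient.mk_surjective c
      have hc : Ideal.Quotient.mk J (x * c) = Ideal.Quotient.mk J b := hc
      change Ideal.Quotient.mk I b = 0
      rw [Ideal.Quotient.eq] at hc
      rw [Ideal.Quotient.eq_zero_iff_mem]
      simpa using sub_mem (I.mul_mem_right c hxI) (hJI hc)
  · intro b
    obtain ⟨b, rfl⟩ := Ideal.Quotient.mk_surjective b
    exact congrArg (Ideal.Quotient.mk J) (mul_left_comm x a b)
  · intro b
    obtain ⟨b, rfl⟩ := Ideal.Quotient.mk_surjective b
    rfl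

theorem Ideal.natDegree_quotientCharpoly (k : Type*) {B : Type*} [Field k] [CommRing B]
    [Algebra k B] [Module.Finite k B] (a : B) (J : Ideal B) :
    (quotientCharpoly k a J).natDegree = finrank k (B ⧸ J) :=
  LinearMap.charpoly_natDegree _

theorem Ideal.monic_quotientCharpoly (k : Type*) {B : Type*} [Field k] [CommRing B]
    [Algebra k B] [Module.Finite k B] (a : B) (J : Ideal B) :
    (quotientCharpoly k a J).Monic :=
  LinearMap.charpoly_monic _

theorem Ideal.quotientCharpoly_top (k : Type*) {B : Type*} [Field k] [CommRing B]
    [Algebra k B] [Module.Finite k B] (a : B) :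
    quotientCharpoly k a (⊤ : Ideal B) = 1 := by
  rw [← (monic_quotientCharpoly k a ⊤).natDegree_eq_zero, natDegree_quotientCharpoly]
  have : Subsingleton (B ⧸ (⊤ : Ideal B)) := Ideal.Quotient.subsingleton_iff.2 rfl
  exact finrank_zero_of_subsingleton

theorem Ideal.quotientCharpoly_bot (k : Type*) {B : Type*} [Field k] [CommRing B]
    [Algebra k B] [Module.Finite k B] (a : B) :
    quotientCharpoly k a (⊥ : Ideal B) = (Algebra.lmul k B a).charpoly := by
  refine (LinearMap.charpoly_eq_of_equiv
    (AlgEquiv.quotientBot k B).symm.toLinearEquiv _ _ fun b => ?_).symm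
  rfl

/-! ### Filtration by products of primes in a Dedekind domain -/

/-- No ideal lies strictly between `I * P` and `I`, so any `x ∈ I` outside `I * P` generates `I ⧸
IP`, with annihilator `P`. -/
theorem Ideal.exists_mem_span_sup_mul {S : Type*} [CommRing S] [IsDedekindDomain S]
    {I P : Ideal S} (hI : I ≠ ⊥) (hP : P.IsMaximal) :
    ∃ x ∈ I, I ≤ span {x} ⊔ I * P ∧ ∀ b, x * b ∈ I * P ↔ b ∈ P := by
  have hlt : I * P < I := by
    refine lt_of_le_of_ne mul_le_left fun h => hP.ne_top ?_
    have : I * P = I * ⊤ := by rw [h, mul_top]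
    exact mul_left_cancel₀ hI this
  obtain ⟨x, hxI, hx⟩ := Set.exists_of_ssubset hlt
  have hP' : P ≤ Submodule.comap (LinearMap.mulLeft S x) (I * P) := fun b hb => mul_mem_mul hxI hb
  refine ⟨x, hxI, ?_, fun b => ⟨fun hb => ?_, fun hb => hP' hb⟩⟩
  -- Write `span {x} ⊔ I * P = I * J`; cancelling `I` gives `P ≤ J`, and `J = P` would put `x` in `I
  -- * P`.
  · obtain ⟨J, hJ⟩ := Ideal.dvd_iff_le.2 (sup_le ((span_singleton_le_iff_mem I).2 hxI) hlt.le)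
    have hPJ : P ≤ J := by
      rw [← Ideal.dvd_iff_le, ← mul_dvd_mul_iff_left hI, ← hJ, Ideal.dvd_iff_le]
      exact le_sup_right
    rcases eq_or_ne J ⊤ with h | h
    · rw [hJ, h, mul_top]
    · rw [← hP.eq_of_le h hPJ] at hJ
      exact absurd (hJ.le (mem_sup_left (mem_span_singleton_self x))) hx
  · have h := hP.eq_of_le (J := Submodule.comap (LinearMap.mulLeft S x) (I * P)) ?_ hP'
    · rw [h]; exact hb
    · intro h
      apply hx
      have : (1 : S) ∈ Submodule.comap (LinearMap.mulLeft S x) (I * P) := h ▸ Submodule.mem_top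
      simpa using this

theorem Ideal.quotientCharpoly_map_prod {k S : Type*} [Field k] [CommRing S] [IsDedekindDomain S]
    {p : Ideal S} [Algebra k (S ⧸ p)] [Module.Finite k (S ⧸ p)] (a : S ⧸ p)
    {κ : Type*} (s : Finset κ) (P : κ → Ideal S) (hP : ∀ i ∈ s, (P i).IsMaximal)
    (hP₀ : ∀ i ∈ s, P i ≠ ⊥) (h : p ≤ ∏ i ∈ s, P i) :
    quotientCharpoly k a ((∏ i ∈ s, P i).map (Ideal.Quotient.mk p)) =
      ∏ i ∈ s, quotientCharpoly k a ((P i).map (Ideal.Quotient.mk p)) := by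
  classical
  induction s using Finset.induction_on with
  | empty => simp [one_eq_top, map_top, quotientCharpoly_top]
  | insert j s hj ih =>
    rw [Finset.prod_insert hj] at h ⊢
    rw [Finset.prod_insert hj, mul_comm (P j)] at *
    have hs : p ≤ ∏ i ∈ s, P i := h.trans mul_le_left
    have hPj : p ≤ P j := h.trans mul_le_right
    rw [← ih (fun i hi => hP i (Finset.mem_insert_of_mem hi))
      (fun i hi => hP₀ i (Finset.mem_insert_of_mem hi)) hs]
    have hI : ∏ i ∈ s, P i ≠ ⊥ :=
      Finset.prod_ne_zero_iff.2 fun i hi => hP₀ i (Finset.mem_insert_of_mem hi)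
    obtain ⟨x, hxI, hle, hx⟩ :=
      exists_mem_span_sup_mul hI (hP j (Finset.mem_insert_self j s))
    refine quotientCharpoly_mul a (Ideal.Quotient.mk p x) (map_mono mul_le_left)
      (mem_map_of_mem _ hxI) ?_ fun b => ?_
    · simpa [map_sup, map_span] using map_mono (f := Ideal.Quotient.mk p) hle
    · obtain ⟨b, rfl⟩ := Ideal.Quotient.mk_surjective b
      rw [← map_mul, mem_quotient_iff_mem h, mem_quotient_iff_mem hPj, hx]

/-! ### Reduction of the minimal polynomial -/

theorem Matrix.Represents.aeval {ι R M : Type*} [Fintype ι] [DecidableEq ι] [CommRing R]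
    [AddCommGroup M] [Module R M] {b : ι → M} {A : Matrix ι ι R} {φ : End R M}
    (h : A.Represents b φ) (p : R[X]) :
    (Polynomial.aeval A p).Represents b (Polynomial.aeval φ p) := by
  induction p using Polynomial.induction_on with
  | C r => simpa using Matrix.Represents.algebraMap r
  | add p q hp hq => simpa using hp.add hq
  | monomial n r ih => simpa [pow_succ, ← mul_assoc] using ih.mul h

/-- Cayley–Hamilton for a family `b` that need be neither independent nor spanning. -/
theorem Matrix.Represents.aeval_charpoly_apply {ι R M : Type*} [Fintype ι] [DecidableEq ι]
    [CommRing R] [AddCommGroup M] [Module R M] {b : ι → M} {A : Matrix ι ι R} {φ : End R M}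
    (h : A.Represents b φ) {m : M} (hm : m ∈ Submodule.span R (Set.range b)) :
    Polynomial.aeval φ A.charpoly m = 0 := by
  rw [← Fintype.range_linearCombination R b] at hm
  obtain ⟨w, rfl⟩ := hm
  rw [← (h.aeval A.charpoly).congr_fun, Matrix.aeval_self_charpoly, Matrix.zero_mulVec, map_zero]

/-- `S` need not be free over `R`. Instead of localizing at `p`, one scales `x` by some `r ≡ 1` mod
`p`, which is invisible after reduction. -/
theorem charpoly_lmul_quotient_map {R S : Type*} [CommRing R] [IsDomain R] [IsIntegrallyClosed R]
    [CommRing S] [IsDomain S] [Algebra R S] [Module.Finite R S] [IsTorsionFree R S]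
    (p : Ideal R) (hp : p.IsMaximal) (x : S)
    [Module.Free (R ⧸ p) (S ⧸ p.map (algebraMap R S))]
    [Module.Finite (R ⧸ p) (S ⧸ p.map (algebraMap R S))]
    (hrank : finrank (R ⧸ p) (S ⧸ p.map (algebraMap R S)) = (minpoly R x).natDegree) :
    (Algebra.lmul (R ⧸ p) (S ⧸ p.map (algebraMap R S)) (Ideal.Quotient.mk _ x)).charpoly =
      (minpoly R x).map (Ideal.Quotient.mk p) := by
  classical
  have : Nontrivial (R ⧸ p) := Ideal.Quotient.nontrivial_iff.2 hp.ne_top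
  set pS := p.map (algebraMap R S)
  let b := finBasis (R ⧸ p) (S ⧸ pS)
  choose c hc using fun i => Ideal.Quotient.mk_surjective (b i)
  have hspan : (⊤ : Submodule R S) ≤ Submodule.span R (Set.range c) ⊔ p • ⊤ := by
    intro s _
    obtain ⟨w, hw⟩ : ∃ w : _ → R, ∀ i, Ideal.Quotient.mk p (w i) =
        b.repr (Ideal.Quotient.mk pS s) i := by
      choose w hw using fun i => Ideal.Quotient.mk_surjective (b.repr (Ideal.Quotient.mk pS s) i)
      exact ⟨w, hw⟩
    refine Submodule.mem_sup.2 ⟨∑ i, w i • c i, ?_, s - ∑ i, w i • c i, ?_, by abel⟩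
    · exact Submodule.sum_mem _ fun i _ =>
        Submodule.smul_mem _ _ (Submodule.subset_span ⟨i, rfl⟩)
    · rw [Ideal.smul_top_eq_map]
      change _ ∈ pS
      rw [← Ideal.Quotient.eq]
      conv_lhs => rw [← b.sum_repr (Ideal.Quotient.mk pS s)]
      simp only [← hw, ← hc, Algebra.smul_def, map_sum, map_mul]
      rfl
  -- Nakayama: lifts `c` of a basis of `S ⧸ pS` span a submodule containing `r • S`.
  obtain ⟨r, hr, hrS⟩ := Submodule.exists_sub_one_mem_and_smul_le_of_fg_of_le_sup
    (Module.Finite.fg_top) le_rfl hspan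
  have hr1 : Ideal.Quotient.mk p r = 1 := by
    rw [← map_one (Ideal.Quotient.mk p)]
    exact Ideal.Quotient.eq.2 hr
  have hr0 : r ≠ 0 := by
    rintro rfl
    simp at hr1
  have hmem : ∀ s : S, r • s ∈ Submodule.span R (Set.range c) := fun s =>
    hrS (Submodule.smul_mem_pointwise_smul s r ⊤ Submodule.mem_top)
  have hA : ∀ j, ∃ w : _ → R, ∑ i, w i • c i = r • x * c j := fun j => by
    rw [smul_mul_assoc]
    exact (Submodule.mem_span_range_iff_exists_fun R).1 (hmem (x * c j))
  choose A' hA' using hA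
  let A : Matrix _ _ R := Matrix.of fun i j => A' j i
  have hrep : A.Represents c (Algebra.lmul R S (r • x)) := Matrix.represents_iff'.2 hA'
  -- Evaluate at `r • 1`, which lies in the span, then cancel `r`.
  have hroot : aeval (r • x) A.charpoly = 0 := by
    have h := hrep.aeval_charpoly_apply (hmem 1)
    rw [Polynomial.aeval_algHom_apply] at h
    simpa [hr0] using h
  have hx : IsIntegral R x := Algebra.IsIntegral.isIntegral x
  have hchar : A.charpoly = (minpoly R x).scaleRoots r := by
    rw [← IsIntegrallyClosed.minpoly_smul hr0 hx]
    refine eq_of_monic_of_dvd_of_natDegree_le (minpoly.monic (hx.smul r)) A.charpoly_monic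
      (minpoly.isIntegrallyClosed_dvd (hx.smul r) hroot) ?_
    rw [IsIntegrallyClosed.minpoly_smul hr0 hx, natDegree_scaleRoots, ← hrank,
      Matrix.charpoly_natDegree_eq_dim, Fintype.card_fin]
  have hmat : LinearMap.toMatrix b b (Algebra.lmul (R ⧸ p) (S ⧸ pS) (Ideal.Quotient.mk _ x)) =
      A.map (Ideal.Quotient.mk p) := by
    rw [← LinearMap.toMatrix_toLin b b (A.map _)]
    congr 1
    refine b.ext fun j => ?_
    rw [Matrix.toLin_self]
    have h := congrArg (Ideal.Quotient.mk pS) (hA' j)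
    have hr1' : Ideal.Quotient.mk pS (algebraMap R S r) = 1 := by
      rw [← Ideal.Quotient.algebraMap_quotient_map_quotient, hr1, map_one]
    simp only [Algebra.smul_def, map_sum, map_mul, hr1', one_mul, hc] at h
    simp only [A, Matrix.map_apply, Matrix.of_apply, Algebra.smul_def]
    exact h.symm
  rw [← LinearMap.charpoly_toMatrix _ b, hmat, Matrix.charpoly_map, hchar,
    map_scaleRoots _ _ _ ?_, hr1, scaleRoots_one]
  rw [(minpoly.monic hx).leadingCoeff, map_one]
  exact one_ne_zero

/-! ### Degrees and assembly -/

theorem Ideal.finrank_quotient_map_quotient_eq_inertiaDeg {R S : Type*} [CommRing R] [CommRing S]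
    [Algebra R S] (p : Ideal R) (P : Ideal S) [p.IsMaximal] [P.IsMaximal] [P.LiesOver p] :
    finrank (R ⧸ p) ((S ⧸ p.map (algebraMap R S)) ⧸ P.map (Ideal.Quotient.mk
      (p.map (algebraMap R S)))) = P.inertiaDeg R := by
  have hle : p.map (algebraMap R S) ≤ P := map_le_iff_le_comap.2 (P.over_def p).le
  rw [inertiaDeg_eq_of_isMaximal p P]
  refine Algebra.finrank_eq_of_equiv_equiv (RingEquiv.refl _)
    (DoubleQuot.quotQuotEquivQuotOfLE hle) ?_
  ext r
  rfl

theorem natDegree_minpoly_of_adjoin_eq_top {K L : Type*} [Field K] [Field L] [Algebra K L]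
    [FiniteDimensional K L] {α : L} (hα : IntermediateField.adjoin K {α} = ⊤) :
    (minpoly K α).natDegree = finrank K L := by
  rw [← IntermediateField.adjoin.finrank (Algebra.IsIntegral.isIntegral α), hα,
    IntermediateField.finrank_top']

set_option linter.deprecated false in
/-- If `x` generates the fraction field extension, its minimal polynomial factors modulo `p`
according to the factorization of `p` upstairs. -/
theorem exists_minpoly_map_quotient_eq_prod {R S : Type*} (K L : Type*) [CommRing R]
    [IsDedekindDomain R] [CommRing S] [IsDedekindDomain S] [Field K] [Field L]
    [Algebra R S] [Algebra R K] [IsFractionRing R K] [Algebra S L] [IsFractionRing S L]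
    [Algebra K L] [Algebra R L] [IsScalarTower R K L] [IsScalarTower R S L]
    [Module.Finite R S] [IsTorsionFree R S] [FiniteDimensional K L]
    (x : S) (hx : IntermediateField.adjoin K {algebraMap S L x} = ⊤)
    (p : Ideal R) (hp : p.IsPrime) (hp₀ : p ≠ ⊥)
    {ι : Type*} [Fintype ι] (P : ι → Ideal S) (e : ι → ℕ) (hP : ∀ i, (P i).IsPrime)
    (he : ∀ i, 0 < e i) (hfac : p.map (algebraMap R S) = ∏ i, P i ^ e i) :
    ∃ g : ι → R[X], (∀ i, (g i).natDegree = (P i).inertiaDeg R) ∧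
      (minpoly R x).map (Ideal.Quotient.mk p) = (∏ i, g i ^ e i).map (Ideal.Quotient.mk p) := by
  have hpm : p.IsMaximal := hp.isMaximal hp₀
  let _ : Field (R ⧸ p) := Ideal.Quotient.field p
  have hrank : finrank (R ⧸ p) (S ⧸ p.map (algebraMap R S)) = finrank K L :=
    Ideal.finrank_quotient_map p K L
  have : Module.Finite (R ⧸ p) (S ⧸ p.map (algebraMap R S)) :=
    Module.Finite.of_restrictScalars_finite R _ _
  have hpS₀ : p.map (algebraMap R S) ≠ ⊥ :=
    (Ideal.map_eq_bot_iff_of_injective (FaithfulSMul.algebraMap_injective R S)).not.2 hp₀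
  have hle : ∀ i, p.map (algebraMap R S) ≤ P i := fun i => by
    rw [hfac, ← Ideal.dvd_iff_le]
    exact (dvd_pow_self _ (he i).ne').trans (Finset.dvd_prod_of_mem _ (Finset.mem_univ i))
  have hP₀ : ∀ i, P i ≠ ⊥ := fun i h => hpS₀ (le_bot_iff.1 (h ▸ hle i))
  have hPm : ∀ i, (P i).IsMaximal := fun i => (hP i).isMaximal (hP₀ i)
  have hover : ∀ i, (P i).LiesOver p := fun i =>
    ⟨hpm.eq_of_le ((hP i).comap _).ne_top (Ideal.map_le_iff_le_comap.1 (hle i))⟩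
  let a := Ideal.Quotient.mk (p.map (algebraMap R S)) x
  let χ i := Ideal.quotientCharpoly (R ⧸ p) a
    ((P i).map (Ideal.Quotient.mk (p.map (algebraMap R S))))
  -- List each prime `e i` times, so that the filtration adds one prime per step.
  have hprod : ∏ i, P i ^ e i = ∏ j ∈ Finset.univ.sigma fun i => (Finset.univ : Finset (Fin (e i))),
      P j.1 := by
    rw [Finset.prod_sigma]
    simp
  have hχ : (Algebra.lmul (R ⧸ p) (S ⧸ p.map (algebraMap R S)) a).charpoly = ∏ i, χ i ^ e i := by
    have h := Ideal.quotientCharpoly_map_prod (k := R ⧸ p) a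
      (Finset.univ.sigma fun i => (Finset.univ : Finset (Fin (e i)))) (fun j => P j.1)
      (fun j _ => hPm j.1) (fun j _ => hP₀ j.1) (hprod ▸ hfac.le)
    rw [← hprod, ← hfac, Ideal.map_quotient_self, Ideal.quotientCharpoly_bot] at h
    rw [h, Finset.prod_sigma]
    simp [χ]
  have hlift : ∀ i, ∃ g : R[X], g.map (Ideal.Quotient.mk p) = χ i ∧
      g.natDegree = (χ i).natDegree ∧ g.Monic := fun i =>
    lifts_and_natDegree_eq_and_monic
      ((mem_lifts _).2 (map_surjective _ Ideal.Quotient.mk_surjective _))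
      (Ideal.monic_quotientCharpoly _ _ _)
  choose g hg hdeg _ using hlift
  refine ⟨g, fun i => ?_, ?_⟩
  · rw [hdeg, Ideal.natDegree_quotientCharpoly]
    exact Ideal.finrank_quotient_map_quotient_eq_inertiaDeg p (P i)
  · rw [Polynomial.map_prod, ← charpoly_lmul_quotient_map p hpm x ?_]
    · simpa [hg] using hχ
    · rw [hrank, ← natDegree_minpoly_of_adjoin_eq_top hx,
        minpoly.isIntegrallyClosed_eq_field_fractions K L (Algebra.IsIntegral.isIntegral (R := R) x),
        (minpoly.monic (Algebra.IsIntegral.isIntegral x)).natDegree_map]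

theorem mainTheorem4
    {K L : Type*} [Field K] [NumberField K] [Field L] [NumberField L] [Algebra K L]
    (α : L) (hα : IntermediateField.adjoin K {α} = ⊤)
    (f : (𝓞 K)[X]) (hf_monic : f.Monic) (hf_irr : Irreducible f) (hf_root : aeval α f = 0)
    (𝔭 : Ideal (𝓞 K)) (h𝔭_prime : 𝔭.IsPrime) (h𝔭_ne : 𝔭 ≠ ⊥)
    {ι : Type*} [Fintype ι] (𝔓 : ι → Ideal (𝓞 L)) (e : ι → ℕ)
    (h𝔓_prime : ∀ i, (𝔓 i).IsPrime) (h𝔓_inj : Function.Injective 𝔓)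
    (he : ∀ i, 0 < e i)
    (hfac : 𝔭.map (algebraMap (𝓞 K) (𝓞 L)) = ∏ i, 𝔓 i ^ e i) :
    ∃ g : ι → (𝓞 K)[X],
      (∀ i, (g i).natDegree = (𝔓 i).inertiaDeg (𝓞 K)) ∧
      f.map (Ideal.Quotient.mk 𝔭) = (∏ i, g i ^ e i).map (Ideal.Quotient.mk 𝔭) := by
  have hint : IsIntegral (𝓞 K) α := ⟨f, hf_monic, by rwa [← aeval_def]⟩
  let x : 𝓞 L := IsIntegralClosure.mk' (𝓞 L) α (isIntegral_trans (R := ℤ) (A := 𝓞 K) α hint)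
  have hx : algebraMap (𝓞 L) L x = α := IsIntegralClosure.algebraMap_mk' _ _ _
  have hroot : aeval x f = 0 := by
    apply FaithfulSMul.algebraMap_injective (𝓞 L) L
    rw [← aeval_algebraMap_apply, hx, hf_root, map_zero]
  have hxint : IsIntegral (𝓞 K) x := Algebra.IsIntegral.isIntegral x
  have hf : f = minpoly (𝓞 K) x :=
    eq_of_monic_of_associated hf_monic (minpoly.monic hxint)
      ((minpoly.irreducible hxint).associated_of_dvd hf_irr
        (minpoly.isIntegrallyClosed_dvd hxint hroot)).symm
  rw [hf]
  exact exists_minpoly_map_quotient_eq_prod K L x (hx ▸ hα) 𝔭 h𝔭_prime h𝔭_ne 𝔓 e h𝔓_prime he hfac
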